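/- Let $q$ be a prime power and $n$ a positive integer. For subspaces $U,V$ of $\mathrm{GF}(q)^n$ let $d_S(U,V)=\dim(U+V)-\dim(U\cap V)$ be the subspace distance and $d_I(U,V)=\tfrac12 d_S(U,V)+\tfrac12|\dim U-\dim V|$ the injection distance. Let $A_S(q,n,d)$ (respectively $A_I(q,n,d)$) be the maximum cardinality of a nonempty set of subspaces of $\mathrm{GF}(q)^n$ (of arbitrary dimensions) in which any two distinct members are at subspace (respectively injection) distance at least $d$. Put $K_q=\prod_{j=1}^\infty(1-q^{-j})$ and $\theta(q)=\sum_{m=0}^\infty q^{-m^2}$. Then for every integer $d$ with $2\le d\le\lfloor n/2\rfloor$, $$A_S(q,n,2d)\le A_S(q,n,2d-1)\le A_I(q,n,d)<2K_q^{-1}\theta(q)\,A_S(q,n,2d),$$ and moreover $$A_I(q,n,d)<2K_q^{-2}\theta(q)\,q^{(n-\lfloor n/2\rfloor)(\lfloor n/2\rfloor-d+1)}.$$ -/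

import Mathlib

open scoped BigOperators

noncomputable section

namespace SubspaceCodes

/-- The projective space `E(q,n)`, that is, the set of all linear subspaces of `F^n`, where
`F` is the finite field with `q` elements. -/
abbrev ProjSpace (F : Type*) [Field F] (n : ℕ) : Type _ := Submodule F (Fin n → F)

/-- The dimension of a subspace, as a real number. -/
def dimR {F : Type*} [Field F] {n : ℕ} (U : ProjSpace F n) : ℝ := (Module.finrank F U : ℝ)

/-- The subspace metric `d_S(U,V) = dim (U + V) - dim (U ∩ V)`. -/
def subspaceDist {F : Type*} [Field F] {n : ℕ} (U V : ProjSpace F n) : ℝ :=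
  dimR (U ⊔ V) - dimR (U ⊓ V)

/-- The injection metric `d_I(U,V) = d_S(U,V) / 2 + |dim U - dim V| / 2`. -/
def injectionDist {F : Type*} [Field F] {n : ℕ} (U V : ProjSpace F n) : ℝ :=
  1 / 2 * subspaceDist U V + 1 / 2 * |dimR U - dimR V|

/-- `C` is a subspace code (a nonempty set of subspaces) whose minimum distance with respect to
`dist`, over all pairs of distinct codewords, is at least `d`. -/
def IsCode {F : Type*} [Field F] {n : ℕ} (dist : ProjSpace F n → ProjSpace F n → ℝ) (d : ℕ)
    (C : Set (ProjSpace F n)) : Prop :=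
  C.Nonempty ∧ ∀ U ∈ C, ∀ V ∈ C, U ≠ V → (d : ℝ) ≤ dist U V

/-- The maximum cardinality of a subspace code with minimum distance `d` with respect to `dist`. -/
def maxCard {F : Type*} [Field F] {n : ℕ} (dist : ProjSpace F n → ProjSpace F n → ℝ) (d : ℕ) : ℕ :=
  sSup {m : ℕ | ∃ C : Set (ProjSpace F n), IsCode dist d C ∧ C.ncard = m}

/-- Over a finite field the maximum in `maxCard` exists. -/
theorem maxCard_isGreatest {F : Type*} [Field F] [Fintype F] {n : ℕ}
    (dist : ProjSpace F n → ProjSpace F n → ℝ) (d : ℕ) :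
    IsGreatest {m : ℕ | ∃ C : Set (ProjSpace F n), IsCode dist d C ∧ C.ncard = m}
      (maxCard dist d) := by
  have hfin : Finite (ProjSpace F n) := inferInstance
  have hne : {m : ℕ | ∃ C : Set (ProjSpace F n), IsCode dist d C ∧ C.ncard = m}.Nonempty := by
    refine ⟨_, {⊥}, ⟨Set.singleton_nonempty _, ?_⟩, rfl⟩
    intro U hU V hV hUV
    exact absurd (hU.trans hV.symm) hUV
  have hbdd : BddAbove {m : ℕ | ∃ C : Set (ProjSpace F n), IsCode dist d C ∧ C.ncard = m} := by
    refine ⟨Nat.card (ProjSpace F n), ?_⟩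
    rintro m ⟨C, -, rfl⟩
    exact Set.ncard_le_card C
  exact ⟨Nat.sSup_mem hne hbdd, fun m hm => le_csSup hbdd hm⟩

/-- `A_S(q,n,d)`, for the subspace metric on the subspaces of `F^n`, with `F` of order `q`. -/
def AS (F : Type*) [Field F] (n d : ℕ) : ℕ :=
  maxCard (F := F) (n := n) subspaceDist d

/-- `A_I(q,n,d)`, for the injection metric on the subspaces of `F^n`, with `F` of order `q`. -/
def AI (F : Type*) [Field F] (n d : ℕ) : ℕ :=
  maxCard (F := F) (n := n) injectionDist d

/-- `K_q = ∏_{j ≥ 1} (1 - q^{-j})`. -/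
def Kq (q : ℕ) : ℝ := ∏' j : ℕ, (1 - ((q : ℝ) ^ (j + 1))⁻¹)

/-- `θ(q) = ∑_{n ≥ 0} q^{-n^2}`. -/
def theta (q : ℕ) : ℝ := ∑' n : ℕ, ((q : ℝ) ^ (n ^ 2))⁻¹

/-- The infinite product defining `K_q` converges. -/
theorem multipliable_Kq {q : ℕ} (hq : 2 ≤ q) :
    Multipliable fun j : ℕ => 1 - ((q : ℝ) ^ (j + 1))⁻¹ := by
  have hq' : (1 : ℝ) < q := by exact_mod_cast hq
  have hs : Summable fun j : ℕ => ((q : ℝ)⁻¹) ^ (j + 1) :=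
    (summable_nat_add_iff 1).2
      (summable_geometric_of_lt_one (by positivity) (inv_lt_one_of_one_lt₀ hq'))
  have h := Real.multipliable_one_add_of_summable hs.neg
  simpa [sub_eq_add_neg] using h

/-- The series defining `θ(q)` converges. -/
theorem summable_theta {q : ℕ} (hq : 2 ≤ q) :
    Summable fun n : ℕ => ((q : ℝ) ^ (n ^ 2))⁻¹ := by
  have hq' : (1 : ℝ) < q := by exact_mod_cast hq
  refine Summable.of_nonneg_of_le (fun n => by positivity) (fun n => ?_)
    (summable_geometric_of_lt_one (by positivity) (inv_lt_one_of_one_lt₀ hq'))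
  rw [inv_pow]
  exact inv_anti₀ (by positivity) (pow_le_pow_right₀ hq'.le (Nat.le_self_pow two_ne_zero n))

end SubspaceCodes

end

/-!
For the upper bounds, split a code with minimum injection distance `d` into the codewords of
dimension at most `ν = ⌊n/2⌋` and the others, which duality makes low-dimensional as well.
Codewords of one dimension `r ≥ d` pairwise meet in dimension less than `k = r - d + 1`, so no
linearly independent `k`-tuple lies in two of them; counting these tuples bounds the number of such
codewords by `K_q⁻¹ q^((n - r) k)`. The exponent is largest at `r = ν` and drops by at least `m²` at
`r = ν - m`, so the sum over all dimensions is less than `K_q⁻¹ θ(q) q^((n - ν)(ν - d + 1))`.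

For the lower bound, the graphs of the linearized polynomials of `q`-degree at most `ν - d`,
regarded as linear maps from a `ν`-dimensional subspace of `GF(q^(n - ν))` into `GF(q^(n - ν))`,
form a code with `q^((n - ν)(ν - d + 1))` codewords: a nonzero polynomial of this kind has at most
`q^(ν - d)` roots, so it defines a map of rank at least `d`.
-/

namespace SubspaceCodes

open Module

section Constants

variable {q : ℕ}

theorem Kq_factor_pos (hq : 2 ≤ q) (j : ℕ) : 0 < 1 - ((q : ℝ) ^ (j + 1))⁻¹ := by
  have hq' : (1 : ℝ) < q := by exact_mod_cast hq
  exact sub_pos.2 (inv_lt_one_of_one_lt₀ (one_lt_pow₀ hq' j.succ_ne_zero))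

theorem Kq_pos (hq : 2 ≤ q) : 0 < Kq q := by
  have hq' : (1 : ℝ) < q := by exact_mod_cast hq
  have hsum : Summable fun j : ℕ => ((q : ℝ)⁻¹) ^ (j + 1) :=
    (summable_nat_add_iff 1).2
      (summable_geometric_of_lt_one (by positivity) (inv_lt_one_of_one_lt₀ hq'))
  have hlog : Summable fun j : ℕ => Real.log (1 - ((q : ℝ) ^ (j + 1))⁻¹) := by
    simpa only [inv_pow, ← sub_eq_add_neg] using Real.summable_log_one_add_of_summable hsum.neg
  rw [Kq, ← Real.rexp_tsum_eq_tprod (Kq_factor_pos hq) hlog]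
  exact Real.exp_pos _

theorem Kq_le_prod (hq : 2 ≤ q) (s : Finset ℕ) :
    Kq q ≤ ∏ j ∈ s, (1 - ((q : ℝ) ^ (j + 1))⁻¹) := by
  refine le_of_tendsto (multipliable_Kq hq).hasProd ?_
  filter_upwards [Filter.eventually_ge_atTop s] with t hst
  exact Finset.prod_le_prod_of_subset_of_le_one hst (fun j _ => (Kq_factor_pos hq j).le)
    fun j _ _ => sub_le_self _ (by positivity)

theorem Kq_le_one (hq : 2 ≤ q) : Kq q ≤ 1 := by
  simpa using Kq_le_prod hq ∅

theorem Kq_inv_le_zpow_neg_two (hq : 2 ≤ q) : (Kq q)⁻¹ ≤ Kq q ^ (-2 : ℤ) := by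
  rw [zpow_neg, ← inv_zpow]
  exact le_self_pow₀ ((one_le_inv₀ (Kq_pos hq)).2 (Kq_le_one hq)) two_ne_zero

theorem Kq_mul_pow_le_prod (hq : 2 ≤ q) {k r : ℕ} (hkr : k ≤ r) :
    Kq q * (q : ℝ) ^ (r * k) ≤ ((∏ i : Fin k, (q ^ r - q ^ i.val) : ℕ) : ℝ) := by
  have factor_eq : ∀ i ∈ Finset.range k,
      ((q ^ r - q ^ i : ℕ) : ℝ) = (1 - ((q : ℝ) ^ ((r - 1 - i) + 1))⁻¹) * (q : ℝ) ^ r := by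
    intro i hi
    have hir : i < r := (Finset.mem_range.1 hi).trans_le hkr
    have hpow : (q : ℝ) ^ r = (q : ℝ) ^ ((r - 1 - i) + 1) * (q : ℝ) ^ i := by
      rw [← pow_add]
      congr 1
      omega
    rw [Nat.cast_sub (Nat.pow_le_pow_right (by omega) hir.le), sub_mul, one_mul, Nat.cast_pow,
      Nat.cast_pow, hpow, inv_mul_cancel_left₀ (by positivity)]
  have hinj : Set.InjOn (fun i => r - 1 - i) (Finset.range k : Set ℕ) := by
    intro i hi j hj hij
    simp only [Finset.coe_range, Set.mem_Iio] at hi hj hij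
    omega
  have hK := Kq_le_prod hq ((Finset.range k).image fun i => r - 1 - i)
  rw [Finset.prod_image hinj] at hK
  rw [Fin.prod_univ_eq_prod_range (fun i => q ^ r - q ^ i) k, Nat.cast_prod,
    Finset.prod_congr rfl factor_eq, Finset.prod_mul_distrib, Finset.prod_const, Finset.card_range,
    pow_mul]
  gcongr

theorem sum_range_lt_theta (hq : 2 ≤ q) (m : ℕ) :
    ∑ i ∈ Finset.range m, ((q : ℝ) ^ (i ^ 2))⁻¹ < theta q :=
  calc ∑ i ∈ Finset.range m, ((q : ℝ) ^ (i ^ 2))⁻¹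
      < ∑ i ∈ Finset.range (m + 1), ((q : ℝ) ^ (i ^ 2))⁻¹ := by
        rw [Finset.sum_range_succ]
        exact lt_add_of_pos_right _ (by positivity)
    _ ≤ theta q := (summable_theta hq).sum_le_tsum _ fun _ _ => by positivity

theorem theta_pos (hq : 2 ≤ q) : 0 < theta q := by
  simpa using sum_range_lt_theta hq 0

theorem sum_pow_lt_theta_mul_pow (hq : 2 ≤ q) {a M : ℕ} (hM : M ≤ a) :
    ∑ k ∈ Finset.range (M + 1), (q : ℝ) ^ ((a + (M - k)) * k) < theta q * (q : ℝ) ^ (a * M) := by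
  have hq1 : (1 : ℝ) ≤ q := by exact_mod_cast (by omega : 1 ≤ q)
  have term_le : ∀ m ∈ Finset.range (M + 1),
      (q : ℝ) ^ ((a + (M - (M - m))) * (M - m)) ≤ ((q : ℝ) ^ (m ^ 2))⁻¹ * (q : ℝ) ^ (a * M) := by
    intro m hm
    obtain ⟨k, rfl⟩ := Nat.exists_eq_add_of_le (Finset.mem_range_succ_iff.1 hm)
    have hexp : m ^ 2 + (a + m) * k ≤ a * (m + k) := by nlinarith [Nat.mul_le_mul_left m hM]
    rw [le_inv_mul_iff₀ (by positivity), ← pow_add, Nat.sub_sub_self (by omega),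
      Nat.add_sub_cancel_left]
    exact pow_le_pow_right₀ hq1 hexp
  rw [← Finset.sum_flip]
  refine (Finset.sum_le_sum term_le).trans_lt ?_
  rw [← Finset.sum_mul]
  exact mul_lt_mul_of_pos_right (sum_range_lt_theta hq _) (by positivity)

end Constants

section InjectionDistance

variable {F V W : Type*} [Field F] [AddCommGroup V] [Module F V] [AddCommGroup W] [Module F W]

/-- The injection distance as the natural number `max (dim U) (dim W) - dim (U ∩ W)`, for subspaces
of an arbitrary vector space. In finite dimension the subtraction is not truncated. -/
noncomputable def injectionDistNat (U W : Submodule F V) : ℕ :=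
  max (finrank F U) (finrank F W) - finrank F ↥(U ⊓ W)

theorem injectionDistNat_self (U : Submodule F V) : injectionDistNat U U = 0 := by
  rw [injectionDistNat, inf_idem, max_self, Nat.sub_self]

theorem injectionDistNat_map {f : V →ₗ[F] W} (hf : Function.Injective f) (U U' : Submodule F V) :
    injectionDistNat (U.map f) (U'.map f) = injectionDistNat U U' := by
  have finrank_map (P : Submodule F V) : finrank F (P.map f) = finrank F P :=
    (P.equivMapOfInjective f hf).finrank_eq.symm
  rw [injectionDistNat, injectionDistNat, ← Submodule.map_inf f hf, finrank_map, finrank_map,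
    finrank_map]

theorem finrank_inf_add_injectionDistNat [FiniteDimensional F V] (U W : Submodule F V) :
    finrank F ↥(U ⊓ W) + injectionDistNat U W = max (finrank F U) (finrank F W) :=
  Nat.add_sub_of_le (le_max_of_le_left (Submodule.finrank_mono inf_le_left))

theorem injectionDistNat_dualAnnihilator [FiniteDimensional F V] (U W : Submodule F V) :
    injectionDistNat U.dualAnnihilator W.dualAnnihilator = injectionDistNat U W := by
  have hU := Subspace.finrank_add_finrank_dualAnnihilator_eq U
  have hW := Subspace.finrank_add_finrank_dualAnnihilator_eq W
  have hsup := Subspace.finrank_add_finrank_dualAnnihilator_eq (U ⊔ W)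
  have hsum := Submodule.finrank_sup_add_finrank_inf_eq U W
  have hdist := finrank_inf_add_injectionDistNat U W
  rw [injectionDistNat, ← Submodule.dualAnnihilator_sup_eq]
  omega

theorem graph_inf_graph (f g : V →ₗ[F] W) :
    f.graph ⊓ g.graph = (LinearMap.ker (f - g)).map (LinearMap.id.prod f) := by
  ext ⟨v, w⟩
  simp only [Submodule.mem_inf, LinearMap.mem_graph_iff, Submodule.mem_map,
    ← LinearMap.eqLocus_eq_ker_sub, LinearMap.mem_eqLocus]
  constructor
  · rintro ⟨hf, hg⟩
    exact ⟨v, hf.symm.trans hg, Prod.ext rfl hf.symm⟩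
  · rintro ⟨u, hu, huv⟩
    cases huv
    exact ⟨rfl, hu⟩

theorem finrank_graph_inf_graph (f g : V →ₗ[F] W) :
    finrank F ↥(f.graph ⊓ g.graph) = finrank F (LinearMap.ker (f - g)) := by
  have hinj : Function.Injective (LinearMap.id.prod f) := fun _ _ h => congrArg Prod.fst h
  rw [graph_inf_graph]
  exact (Submodule.equivMapOfInjective _ hinj _).finrank_eq.symm

theorem finrank_graph (f : V →ₗ[F] W) : finrank F f.graph = finrank F V := by
  rw [← inf_idem f.graph, finrank_graph_inf_graph, sub_self, LinearMap.ker_zero, finrank_top]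

theorem injectionDistNat_graph [FiniteDimensional F V] (f g : V →ₗ[F] W) :
    injectionDistNat f.graph g.graph = finrank F (LinearMap.range (f - g)) := by
  have hrank := LinearMap.finrank_range_add_finrank_ker (f - g)
  rw [injectionDistNat, finrank_graph, finrank_graph, max_self, finrank_graph_inf_graph]
  omega

end InjectionDistance

section UpperBound

variable {F V : Type*} [Field F] [AddCommGroup V] [Module F V]

/-- The linearly independent `k`-tuples of vectors of `U`, by which subspaces with small pairwise
intersections are counted. -/
def independentTuples (U : Submodule F V) (k : ℕ) : Set (Fin k → V) :=
  {s | LinearIndependent F s ∧ ∀ i, s i ∈ U}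

theorem disjoint_independentTuples [FiniteDimensional F V] {U W : Submodule F V} {k : ℕ}
    (h : finrank F ↥(U ⊓ W) < k) : Disjoint (independentTuples U k) (independentTuples W k) := by
  rw [Set.disjoint_left]
  rintro s ⟨hs, hsU⟩ ⟨-, hsW⟩
  have hspan : Submodule.span F (Set.range s) ≤ U ⊓ W :=
    Submodule.span_le.2 (Set.range_subset_iff.2 fun i => ⟨hsU i, hsW i⟩)
  have := Submodule.finrank_mono hspan
  rw [finrank_span_eq_card hs, Fintype.card_fin] at this
  omega

variable [Fintype F] [FiniteDimensional F V]

theorem ncard_independentTuples {U : Submodule F V} {k : ℕ} (hk : k ≤ finrank F U) :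
    (independentTuples U k).ncard =
      ∏ i : Fin k, (Fintype.card F ^ finrank F U - Fintype.card F ^ i.val) := by
  have : Finite V := Module.finite_of_finite F
  have himage : independentTuples U k =
      (fun (s : Fin k → U) i => (s i : V)) '' {s | LinearIndependent F s} := by
    ext s
    refine ⟨fun ⟨hs, hsU⟩ => ⟨fun i => ⟨s i, hsU i⟩, .of_comp U.subtype hs, rfl⟩, ?_⟩
    rintro ⟨t, ht, rfl⟩
    exact ⟨ht.map' U.subtype U.ker_subtype, fun i => (t i).2⟩
  have hinj : Function.Injective fun (s : Fin k → U) i => (s i : V) :=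
    Subtype.val_injective.comp_left
  rw [himage, Set.ncard_image_of_injective _ hinj, ← Nat.card_coe_set_eq]
  exact card_linearIndependent hk

theorem card_mul_prod_le {S : Finset (Submodule F V)} {k r : ℕ} (hkr : k ≤ r)
    (hr : ∀ U ∈ S, finrank F U = r)
    (hS : (S : Set (Submodule F V)).Pairwise fun U W => finrank F ↥(U ⊓ W) < k) :
    S.card * ∏ i : Fin k, (Fintype.card F ^ r - Fintype.card F ^ i.val) ≤
      Fintype.card F ^ (finrank F V * k) := by
  classical
  have : Finite V := Module.finite_of_finite F
  have : Fintype V := Fintype.ofFinite V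
  let tuples : Submodule F V → Finset (Fin k → V) := fun U =>
    (Set.toFinite (independentTuples U k)).toFinset
  have hdisj : (S : Set (Submodule F V)).PairwiseDisjoint tuples := fun U hU W hW hne => by
    simpa [tuples, Function.onFun] using disjoint_independentTuples (hS hU hW hne)
  have hcard : ∀ U ∈ S, (tuples U).card =
      ∏ i : Fin k, (Fintype.card F ^ r - Fintype.card F ^ i.val) := fun U hU => by
    have hkU : k ≤ finrank F U := hkr.trans_eq (hr U hU).symm
    rw [← Set.ncard_eq_toFinset_card, ncard_independentTuples hkU, hr U hU]
  rw [← smul_eq_mul, ← Finset.sum_const, ← Finset.sum_congr rfl hcard, ← Finset.card_biUnion hdisj]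
  refine (Finset.card_le_univ _).trans_eq ?_
  rw [Fintype.card_fun, Fintype.card_fin, Module.card_eq_pow_finrank (K := F), pow_mul]

theorem card_le_of_finrank_inf_lt {S : Finset (Submodule F V)} {k r : ℕ} (hkr : k ≤ r)
    (hr : ∀ U ∈ S, finrank F U = r)
    (hS : (S : Set (Submodule F V)).Pairwise fun U W => finrank F ↥(U ⊓ W) < k) :
    (S.card : ℝ) ≤ (Kq (Fintype.card F))⁻¹ * (Fintype.card F : ℝ) ^ ((finrank F V - r) * k) := by
  have hq : 2 ≤ Fintype.card F := Fintype.one_lt_card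
  have hq1 : (1 : ℝ) ≤ Fintype.card F := by exact_mod_cast Fintype.card_pos
  set q := Fintype.card F
  rw [le_inv_mul_iff₀ (Kq_pos hq)]
  refine le_of_mul_le_mul_right ?_ (by positivity : (0 : ℝ) < q ^ (r * k))
  calc Kq q * S.card * (q : ℝ) ^ (r * k)
      = S.card * (Kq q * (q : ℝ) ^ (r * k)) := by ring
    _ ≤ S.card * ((∏ i : Fin k, (q ^ r - q ^ i.val) : ℕ) : ℝ) := by
        gcongr
        exact Kq_mul_pow_le_prod hq hkr
    _ ≤ (q : ℝ) ^ (finrank F V * k) := by exact_mod_cast card_mul_prod_le hkr hr hS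
    _ ≤ (q : ℝ) ^ ((finrank F V - r) * k + r * k) := by
        rw [← add_mul]
        exact pow_le_pow_right₀ hq1 (Nat.mul_le_mul_right k le_tsub_add)
    _ = (q : ℝ) ^ ((finrank F V - r) * k) * (q : ℝ) ^ (r * k) := pow_add _ _ _

/-- The truncated subtraction merges all dimensions less than `d` into the level `k = 0`, which
contains at most one codeword. -/
theorem card_le_of_finrank_add_one_sub_eq {S : Finset (Submodule F V)} {d k : ℕ} (hd : 1 ≤ d)
    (hk : ∀ U ∈ S, finrank F U + 1 - d = k)
    (hS : (S : Set (Submodule F V)).Pairwise (d ≤ injectionDistNat · ·)) :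
    (S.card : ℝ) ≤ (Kq (Fintype.card F))⁻¹ *
      (Fintype.card F : ℝ) ^ ((finrank F V + 1 - d - k) * k) := by
  have hq : 2 ≤ Fintype.card F := Fintype.one_lt_card
  rcases k.eq_zero_or_pos with rfl | hkpos
  · have hcard : S.card ≤ 1 := Finset.card_le_one.2 fun U hU W hW => by
      by_contra hne
      have hdist : d ≤ injectionDistNat U W := hS hU hW hne
      have := finrank_inf_add_injectionDistNat U W
      have := hk U hU
      have := hk W hW
      omega
    calc (S.card : ℝ) ≤ 1 := by exact_mod_cast hcard
      _ ≤ (Kq (Fintype.card F))⁻¹ := (one_le_inv₀ (Kq_pos hq)).2 (Kq_le_one hq)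
      _ = _ := by rw [mul_zero, pow_zero, mul_one]
  · have hr : ∀ U ∈ S, finrank F U = k + d - 1 := fun U hU => by
      have := hk U hU
      omega
    have hexp : finrank F V + 1 - d - k = finrank F V - (k + d - 1) := by omega
    rw [hexp]
    refine card_le_of_finrank_inf_lt (by omega) hr fun U hU W hW hne => ?_
    have hdist : d ≤ injectionDistNat U W := hS hU hW hne
    have := finrank_inf_add_injectionDistNat U W
    rw [hr U hU, hr W hW, max_self] at this
    omega

theorem card_lt_of_finrank_le {C : Finset (Submodule F V)} {ν d : ℕ} (hd : 1 ≤ d) (hdν : d ≤ ν)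
    (hν : 2 * ν ≤ finrank F V) (hCν : ∀ U ∈ C, finrank F U ≤ ν)
    (hC : (C : Set (Submodule F V)).Pairwise (d ≤ injectionDistNat · ·)) :
    (C.card : ℝ) < (Kq (Fintype.card F))⁻¹ * theta (Fintype.card F) *
      (Fintype.card F : ℝ) ^ ((finrank F V - ν) * (ν - d + 1)) := by
  classical
  have hq : 2 ≤ Fintype.card F := Fintype.one_lt_card
  set q := Fintype.card F
  set M := ν - d + 1
  let level : Submodule F V → ℕ := fun U => finrank F U + 1 - d
  have hlevel : ∀ U ∈ C, level U ∈ Finset.range (M + 1) := fun U hU => by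
    have := hCν U hU
    simp only [level, Finset.mem_range]
    omega
  have hfiber : ∀ k ∈ Finset.range (M + 1), ((C.filter (level · = k)).card : ℝ) ≤
      (Kq q)⁻¹ * (q : ℝ) ^ ((finrank F V - ν + (M - k)) * k) := fun k hk => by
    have hexp : finrank F V - ν + (M - k) = finrank F V + 1 - d - k := by
      rw [Finset.mem_range] at hk
      omega
    rw [hexp]
    exact card_le_of_finrank_add_one_sub_eq hd (fun U hU => (Finset.mem_filter.1 hU).2)
      (hC.mono (Finset.coe_subset.2 (Finset.filter_subset _ _)))
  calc (C.card : ℝ)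
      = ∑ k ∈ Finset.range (M + 1), ((C.filter (level · = k)).card : ℝ) := by
        exact_mod_cast Finset.card_eq_sum_card_fiberwise hlevel
    _ ≤ (Kq q)⁻¹ * ∑ k ∈ Finset.range (M + 1), (q : ℝ) ^ ((finrank F V - ν + (M - k)) * k) := by
        rw [Finset.mul_sum]
        exact Finset.sum_le_sum hfiber
    _ < (Kq q)⁻¹ * (theta q * (q : ℝ) ^ ((finrank F V - ν) * M)) :=
        mul_lt_mul_of_pos_left (sum_pow_lt_theta_mul_pow hq (by omega)) (inv_pos.2 (Kq_pos hq))
    _ = _ := (mul_assoc _ _ _).symm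

theorem card_lt_of_le_finrank {C : Finset (Submodule F V)} {ν d : ℕ} (hd : 1 ≤ d) (hdν : d ≤ ν)
    (hν : 2 * ν ≤ finrank F V) (hCν : ∀ U ∈ C, finrank F V - ν ≤ finrank F U)
    (hC : (C : Set (Submodule F V)).Pairwise (d ≤ injectionDistNat · ·)) :
    (C.card : ℝ) < (Kq (Fintype.card F))⁻¹ * theta (Fintype.card F) *
      (Fintype.card F : ℝ) ^ ((finrank F V - ν) * (ν - d + 1)) := by
  classical
  have hinj : Function.Injective
      (Submodule.dualAnnihilator : Submodule F V → Submodule F (Dual F V)) :=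
    fun _ _ => Subspace.dualAnnihilator_inj.1
  have hdim : finrank F (Dual F V) = finrank F V := Subspace.dual_finrank_eq
  have hlow : ∀ U ∈ C.image Submodule.dualAnnihilator, finrank F U ≤ ν := by
    simp only [Finset.forall_mem_image]
    intro U hU
    have := Subspace.finrank_add_finrank_dualAnnihilator_eq U
    have := hCν U hU
    omega
  have hpair : (C.image Submodule.dualAnnihilator : Set (Submodule F (Dual F V))).Pairwise
      (d ≤ injectionDistNat · ·) := by
    rw [Finset.coe_image, hinj.injOn.pairwise_image]
    simpa only [Set.Pairwise, Function.onFun, injectionDistNat_dualAnnihilator] using hC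
  have hcard := card_lt_of_finrank_le hd hdν (hν.trans_eq hdim.symm) hlow hpair
  rwa [Finset.card_image_of_injective _ hinj, hdim] at hcard

theorem card_lt_of_pairwise_le_injectionDistNat {C : Finset (Submodule F V)} {d : ℕ} (hd : 1 ≤ d)
    (hdV : d ≤ finrank F V / 2)
    (hC : (C : Set (Submodule F V)).Pairwise (d ≤ injectionDistNat · ·)) :
    (C.card : ℝ) < 2 * (Kq (Fintype.card F))⁻¹ * theta (Fintype.card F) *
      (Fintype.card F : ℝ) ^
        ((finrank F V - finrank F V / 2) * (finrank F V / 2 - d + 1)) := by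
  classical
  set ν := finrank F V / 2
  have hsub (p : Submodule F V → Prop) [DecidablePred p] :
      (C.filter p : Set (Submodule F V)).Pairwise (d ≤ injectionDistNat · ·) :=
    hC.mono (Finset.coe_subset.2 (Finset.filter_subset _ _))
  have hlow := card_lt_of_finrank_le hd hdV (by omega) (fun U hU => (Finset.mem_filter.1 hU).2)
    (hsub (finrank F · ≤ ν))
  have hhigh := card_lt_of_le_finrank hd hdV (by omega)
    (fun U hU => by have := (Finset.mem_filter.1 hU).2; omega) (hsub (¬ finrank F · ≤ ν))
  rw [← Finset.card_filter_add_card_filter_not (s := C) (finrank F · ≤ ν), Nat.cast_add]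
  linarith

end UpperBound

section Gabidulin

open Polynomial

/-- The linearized polynomial `∑ aᵢ X^(q^i)` of `q`-degree less than `k`. -/
noncomputable def linearizedPolynomial {R : Type*} [Semiring R] (q : ℕ) {k : ℕ} (a : Fin k → R) :
    R[X] :=
  ∑ i : Fin k, C (a i) * X ^ q ^ i.val

theorem linearizedPolynomial_ne_zero {R : Type*} [Semiring R] {q k : ℕ} (hq : 1 < q)
    {a : Fin k → R} (ha : a ≠ 0) : linearizedPolynomial q a ≠ 0 := by
  obtain ⟨i, hi⟩ := Function.ne_iff.1 ha
  have hcoeff : (linearizedPolynomial q a).coeff (q ^ i.val) = a i := by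
    simp [linearizedPolynomial, coeff_X_pow, Nat.pow_right_inj hq, Fin.val_inj]
  exact fun h => hi (by rw [← hcoeff, h, coeff_zero, Pi.zero_apply])

theorem natDegree_linearizedPolynomial_le {R : Type*} [Semiring R] {q k : ℕ} (hq : 0 < q)
    (a : Fin k → R) : (linearizedPolynomial q a).natDegree ≤ q ^ (k - 1) :=
  natDegree_sum_le_of_forall_le _ _ fun _ _ =>
    (natDegree_C_mul_X_pow_le _ _).trans (Nat.pow_le_pow_right hq (by omega))

variable {F L W : Type*} [Field F] [Fintype F] [Field L] [Algebra F L] [AddCommGroup W] [Module F W]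

/-- The encoder `a ↦ (w ↦ ∑ aᵢ ι(w)^(q^i))` of the Gabidulin code of dimension `k`. In coordinates
of `L` over `F`, the code consists of `dim L × dim W` matrices, and `ι` specifies the evaluation
points. -/
noncomputable def gabidulinMap (ι : W →ₗ[F] L) (k : ℕ) : (Fin k → L) →ₗ[L] (W →ₗ[F] L) :=
  Fintype.linearCombination L fun i : Fin k =>
    (FiniteField.frobeniusAlgHom F L ^ i.val).toLinearMap ∘ₗ ι

theorem gabidulinMap_apply (ι : W →ₗ[F] L) {k : ℕ} (a : Fin k → L) (w : W) :
    gabidulinMap ι k a w = (linearizedPolynomial (Fintype.card F) a).eval (ι w) := by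
  simp [gabidulinMap, linearizedPolynomial, Fintype.linearCombination_apply, eval_finsetSum,
    AlgHom.coe_pow, FiniteField.coe_frobeniusAlgHom, pow_iterate]

variable {ι : W →ₗ[F] L} {k : ℕ} {a : Fin k → L}

theorem finrank_ker_gabidulinMap_lt [FiniteDimensional F W] (hι : Function.Injective ι)
    (ha : a ≠ 0) : finrank F (LinearMap.ker (gabidulinMap ι k a)) < k := by
  have hq : 1 < Fintype.card F := Fintype.one_lt_card
  set P := linearizedPolynomial (Fintype.card F) a
  have hP : P ≠ 0 := linearizedPolynomial_ne_zero hq ha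
  have hroots : ι '' LinearMap.ker (gabidulinMap ι k a) ⊆ P.rootSet L := by
    rintro _ ⟨w, hw, rfl⟩
    rw [mem_rootSet_of_ne hP, coe_aeval_eq_eval, ← gabidulinMap_apply]
    exact hw
  have hcard := calc
    Fintype.card F ^ finrank F (LinearMap.ker (gabidulinMap ι k a))
      = (ι '' LinearMap.ker (gabidulinMap ι k a)).ncard := by
        rw [Set.ncard_image_of_injective _ hι, ← Nat.card_coe_set_eq, ← Nat.card_eq_fintype_card]
        exact Module.natCard_eq_pow_finrank.symm
    _ ≤ (P.rootSet L).ncard := Set.ncard_le_ncard hroots (rootSet_finite P L)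
    _ ≤ P.natDegree := ncard_rootSet_le P L
    _ ≤ Fintype.card F ^ (k - 1) := natDegree_linearizedPolynomial_le hq.le a
  have hker := (Nat.pow_le_pow_iff_right hq).1 hcard
  obtain ⟨i, -⟩ := Function.ne_iff.1 ha
  have hk := i.pos
  omega

theorem finrank_lt_finrank_range_gabidulinMap_add [FiniteDimensional F W]
    (hι : Function.Injective ι) (ha : a ≠ 0) :
    finrank F W < finrank F (LinearMap.range (gabidulinMap ι k a)) + k := by
  have hrank := LinearMap.finrank_range_add_finrank_ker (gabidulinMap ι k a)
  have hker := finrank_ker_gabidulinMap_lt hι ha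
  omega

end Gabidulin

theorem exists_field_extension_finrank_eq (F : Type*) [Field F] [Finite F] {m : ℕ} (hm : m ≠ 0) :
    ∃ (L : Type) (_ : Field L) (_ : Algebra F L), finrank F L = m := by
  obtain ⟨p, _⟩ := CharP.exists F
  have : Fact p.Prime := ⟨CharP.char_is_prime F p⟩
  have : NeZero m := ⟨hm⟩
  exact ⟨FiniteField.Extension F p m, inferInstance, inferInstance,
    FiniteField.finrank_extension F p m⟩

theorem exists_constantDim_code {F V : Type*} [Field F] [Fintype F] [AddCommGroup V] [Module F V]
    [FiniteDimensional F V] {r d : ℕ} (hd : 1 ≤ d) (hdr : d ≤ r) (hr : 2 * r ≤ finrank F V) :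
    ∃ C : Finset (Submodule F V),
      C.card = Fintype.card F ^ ((finrank F V - r) * (r - d + 1)) ∧
      (∀ U ∈ C, finrank F U = r) ∧
      (C : Set (Submodule F V)).Pairwise (d ≤ injectionDistNat · ·) := by
  classical
  obtain ⟨L, _, _, hL⟩ := exists_field_extension_finrank_eq F (m := finrank F V - r) (by omega)
  have : FiniteDimensional F L := FiniteDimensional.of_finrank_pos (by omega)
  have : Finite L := Module.finite_of_finite F
  have : Fintype L := Fintype.ofFinite L
  obtain ⟨ι, hι⟩ : ∃ ι : (Fin r → F) →ₗ[F] L, Function.Injective ι :=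
    finrank_le_iff_exists_linearMap.1 (by rw [finrank_fin_fun, hL]; omega)
  let e : ((Fin r → F) × L) ≃ₗ[F] V := LinearEquiv.ofFinrankEq _ _ (by
    rw [finrank_prod, finrank_fin_fun, hL]; omega)
  let codeword : (Fin (r - d + 1) → L) → Submodule F V := fun a =>
    (gabidulinMap ι _ a).graph.map (e : (Fin r → F) × L →ₗ[F] V)
  have hdist : ∀ a b, a ≠ b → d ≤ injectionDistNat (codeword a) (codeword b) := by
    intro a b hab
    have hrank := finrank_lt_finrank_range_gabidulinMap_add hι (sub_ne_zero.2 hab)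
    rw [finrank_fin_fun, map_sub] at hrank
    rw [injectionDistNat_map e.injective, injectionDistNat_graph]
    omega
  have hinj : Function.Injective codeword := by
    intro a b hab
    by_contra hne
    have := hdist a b hne
    rw [hab, injectionDistNat_self] at this
    omega
  refine ⟨Finset.univ.image codeword, ?_, ?_, ?_⟩
  · rw [Finset.card_image_of_injective _ hinj, Finset.card_univ, Fintype.card_fun, Fintype.card_fin,
      Module.card_eq_pow_finrank (K := F), hL, pow_mul]
  · simp only [Finset.forall_mem_image]
    intro a _
    rw [LinearEquiv.finrank_map_eq, finrank_graph, finrank_fin_fun]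
  · rw [Finset.coe_image, Finset.coe_univ, hinj.injOn.pairwise_image]
    exact fun a _ b _ => hdist a b

section ProjSpace

variable {F : Type*} [Field F] {n : ℕ}

theorem subspaceDist_eq (U W : ProjSpace F n) :
    subspaceDist U W = finrank F U + finrank F W - 2 * finrank F ↥(U ⊓ W) := by
  have hsum : (finrank F ↥(U ⊔ W) + finrank F ↥(U ⊓ W) : ℝ) = finrank F U + finrank F W := by
    exact_mod_cast Submodule.finrank_sup_add_finrank_inf_eq U W
  rw [subspaceDist, dimR, dimR]
  linarith

theorem injectionDist_eq_natCast (U W : ProjSpace F n) :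
    injectionDist U W = injectionDistNat U W := by
  have hdist : (finrank F ↥(U ⊓ W) + injectionDistNat U W : ℝ) =
      max (finrank F U : ℝ) (finrank F W) := by
    exact_mod_cast finrank_inf_add_injectionDistNat U W
  rw [sup_eq_half_smul_add_add_abs_sub' ℝ, smul_eq_mul] at hdist
  rw [injectionDist, subspaceDist_eq, dimR, dimR, abs_sub_comm]
  linarith

theorem subspaceDist_le_two_mul_injectionDist (U W : ProjSpace F n) :
    subspaceDist U W ≤ 2 * injectionDist U W := by
  rw [injectionDist]
  linarith [abs_nonneg (dimR U - dimR W)]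

theorem two_mul_injectionDist_of_finrank_eq {U W : ProjSpace F n}
    (h : finrank F U = finrank F W) : 2 * injectionDist U W = subspaceDist U W := by
  rw [injectionDist, dimR, dimR, h, sub_self, abs_zero]
  ring

theorem maxCard_le_maxCard [Finite F] {d d' : ℕ} {dist dist' : ProjSpace F n → ProjSpace F n → ℝ}
    (h : ∀ U W, (d : ℝ) ≤ dist U W → (d' : ℝ) ≤ dist' U W) :
    maxCard dist d ≤ maxCard dist' d' := by
  have := Fintype.ofFinite F
  obtain ⟨C, hC, hcard⟩ := (maxCard_isGreatest dist d).1
  exact (maxCard_isGreatest dist' d').2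
    ⟨C, ⟨hC.1, fun U hU W hW hne => h U W (hC.2 U hU W hW hne)⟩, hcard⟩

theorem AS_anti (F : Type*) [Field F] [Finite F] (n : ℕ) : Antitone (AS F n) :=
  fun _ _ hd => maxCard_le_maxCard fun _ _ h => (Nat.cast_le.2 hd).trans h

theorem AS_two_mul_sub_one_le_AI (F : Type*) [Field F] [Finite F] (n d : ℕ) :
    AS F n (2 * d - 1) ≤ AI F n d := by
  refine maxCard_le_maxCard fun U W h => ?_
  have h2 := h.trans (subspaceDist_le_two_mul_injectionDist U W)
  rw [injectionDist_eq_natCast] at h2 ⊢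
  norm_cast at h2 ⊢
  omega

theorem AI_lt [Fintype F] {d : ℕ} (hd : 1 ≤ d) (hdn : d ≤ n / 2) :
    (AI F n d : ℝ) < 2 * (Kq (Fintype.card F))⁻¹ * theta (Fintype.card F) *
      (Fintype.card F : ℝ) ^ ((n - n / 2) * (n / 2 - d + 1)) := by
  obtain ⟨C, ⟨-, hC⟩, hcard⟩ := (maxCard_isGreatest (F := F) (n := n) injectionDist d).1
  have hpair : ((Set.toFinite C).toFinset : Set (ProjSpace F n)).Pairwise
      (d ≤ injectionDistNat · ·) := by
    rw [Set.Finite.coe_toFinset]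
    intro U hU W hW hne
    exact_mod_cast (hC U hU W hW hne).trans_eq (injectionDist_eq_natCast U W)
  have hn : finrank F (Fin n → F) = n := finrank_fin_fun F
  have hlt := card_lt_of_pairwise_le_injectionDistNat hd (by rwa [hn]) hpair
  rwa [← Set.ncard_eq_toFinset_card, hcard, hn] at hlt

theorem pow_le_AS [Fintype F] {d : ℕ} (hd : 1 ≤ d) (hdn : d ≤ n / 2) :
    Fintype.card F ^ ((n - n / 2) * (n / 2 - d + 1)) ≤ AS F n (2 * d) := by
  have hn : finrank F (Fin n → F) = n := finrank_fin_fun F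
  obtain ⟨C, hcard, hdim, hC⟩ := exists_constantDim_code (F := F) (V := Fin n → F) hd hdn (by omega)
  rw [hn] at hcard
  refine (maxCard_isGreatest subspaceDist (2 * d)).2
    ⟨C, ⟨?_, fun U hU W hW hne => ?_⟩, (Set.ncard_coe_finset C).trans hcard⟩
  · have : 0 < C.card := hcard ▸ pow_pos Fintype.card_pos _
    exact Finset.coe_nonempty.2 (Finset.card_pos.1 this)
  · rw [← two_mul_injectionDist_of_finrank_eq ((hdim U hU).trans (hdim W hW).symm),
      injectionDist_eq_natCast]
    exact_mod_cast Nat.mul_le_mul_left 2 (hC hU hW hne)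

end ProjSpace

end SubspaceCodes

open SubspaceCodes in
theorem mainTheorem9_general {F : Type*} [Field F] [Fintype F] {n d : ℕ} (hd : 1 ≤ d)
    (hdn : d ≤ n / 2) :
    (AS F n (2 * d) ≤ AS F n (2 * d - 1) ∧
      AS F n (2 * d - 1) ≤ AI F n d ∧
      (AI F n d : ℝ) <
        2 * (Kq (Fintype.card F))⁻¹ * theta (Fintype.card F) * (AS F n (2 * d) : ℝ)) ∧
    (AI F n d : ℝ) <
      2 * (Kq (Fintype.card F))⁻¹ * theta (Fintype.card F) *
        (Fintype.card F : ℝ) ^ ((n - n / 2) * (n / 2 - d + 1)) := by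
  have hq : 2 ≤ Fintype.card F := Fintype.one_lt_card
  have hK := Kq_pos hq
  have hθ := theta_pos hq
  have hAI := AI_lt (F := F) hd hdn
  refine ⟨⟨AS_anti F n (Nat.sub_le _ _), AS_two_mul_sub_one_le_AI F n d, hAI.trans_le ?_⟩, hAI⟩
  gcongr
  exact_mod_cast pow_le_AS (F := F) hd hdn

theorem mainTheorem9 {F : Type*} [Field F] [Fintype F] (q : ℕ) (hq : Fintype.card F = q)
    (n d : ℕ) (hd : 2 ≤ d) (hdn : d ≤ n / 2) :
    (SubspaceCodes.AS F n (2 * d) ≤ SubspaceCodes.AS F n (2 * d - 1) ∧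
      SubspaceCodes.AS F n (2 * d - 1) ≤ SubspaceCodes.AI F n d ∧
      (SubspaceCodes.AI F n d : ℝ) <
        2 * (SubspaceCodes.Kq q)⁻¹ * SubspaceCodes.theta q *
          (SubspaceCodes.AS F n (2 * d) : ℝ)) ∧
    (SubspaceCodes.AI F n d : ℝ) <
      2 * (SubspaceCodes.Kq q) ^ (-2 : ℤ) * SubspaceCodes.theta q *
        (q : ℝ) ^ ((n - n / 2) * (n / 2 - d + 1)) := by
  subst hq
  have hq : 2 ≤ Fintype.card F := Fintype.one_lt_card
  have hθ := SubspaceCodes.theta_pos hq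
  refine (mainTheorem9_general (by omega) hdn).imp_right fun h => h.trans_le ?_
  gcongr
  exact SubspaceCodes.Kq_inv_le_zpow_neg_two hq
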